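/- For positive integers $d$ and $s_1,\dots,s_d$ with $s_1\ge 2$, let $$\zeta(s_1,\dots,s_d)=\sum_{k_1>\cdots>k_d>0}\frac{1}{k_1^{s_1}\cdots k_d^{s_d}}$$ denote the (convergent) multiple zeta value. Let $a,b$ be real numbers and let $n\ge 3$ be an integer. Then $$\sum_{\substack{j\ge 2,\;k,l\ge 1\\ j+k+l=n}}\bigl[a^{j+k-1}b^{l}+a^{j}b^{k+l-1}\bigr]\zeta(j,k,l)-\sum_{\substack{j\ge 2,\;k\ge 1\\ j+k=n}}\bigl[a^{j-1}b^{k}+a^{j}b^{k-1}\bigr]\zeta(j,k)$$ $$=\sum_{k=2}^{n-2}a^{k}b^{\,n-1-k}\zeta(k,1,n-1-k)-ab^{\,n-2}\zeta(2,n-2)-a^{n-1}\zeta(n-1,1),$$ where empty sums are $0$ and $x^0=1$ for every real $x$, including $x=0$. -/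

import Mathlib

/-- The multiple zeta value
`ζ(s₁, …, s_d) = ∑_{k₁ > ⋯ > k_d > 0} 1 / (k₁ ^ s₁ ⋯ k_d ^ s_d)`.
The series has nonnegative terms and converges whenever `s₁ ≥ 2` and all `sᵢ ≥ 1`. -/
noncomputable def multiZeta {d : ℕ} (s : Fin d → ℕ) : ℝ :=
  ∑' k : {k : Fin d → ℕ // StrictAnti k ∧ ∀ i, 0 < k i},
    1 / ∏ i, (k.1 i : ℝ) ^ s i

/-! Grouping the triple sums by the exponents of `a` and `b` reduces the theorem to one relation for
each pair `(p, q)` with `p + q = n - 1` (`sum_multiZeta_eq`), weighted by `a ^ p * b ^ q`. The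
boundary terms of the regrouping form the right-hand side.

The relation for `(p, q)` comes from partial fractions. Each of its two triple sums is geometric in
the running exponent (`sum_inv_pow_mul_inv_pow`). Summing out one variable then leaves double sums
of `1 / (k ^ p * m ^ q)` weighted by harmonic numbers `H` (`sum_tripleSum_split_first`,
`sum_tripleSum_split_second`). On adding, `H (k - m - 1)` cancels and `(H k - H (k - 1)) + (H m - H
(m - 1)) = 1 / k + 1 / m` remains, which raises one exponent at a time.

Sums are taken in `[0, ∞]`, where interchanges are free; only the final cancellation needs
finiteness, which follows from slow growth of `H`. -/

open Finset in
/-- Geometric sum of `k⁻ʲ l^(j - p - 1)` over `2 ≤ j ≤ p`, in partial fraction form. -/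
lemma sum_inv_pow_mul_inv_pow {x y : ℝ} (hx : 0 < x) (hy : 0 < y) (hxy : y < x) {p : ℕ}
    (hp : 1 ≤ p) :
    ∑ j ∈ Icc 2 p, 1 / (x ^ j * y ^ (p + 1 - j)) + 1 / (x ^ p * (x - y)) =
      1 / (x * (x - y) * y ^ (p - 1)) := by
  have hd : x - y ≠ 0 := (sub_pos.2 hxy).ne'
  induction p, hp using Nat.le_induction with
  | base => simp
  | succ p hp ih =>
    have h1 : ∑ j ∈ Icc 2 p, 1 / (x ^ j * y ^ (p + 1 + 1 - j)) =
        (∑ j ∈ Icc 2 p, 1 / (x ^ j * y ^ (p + 1 - j))) / y := by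
      rw [sum_div]
      refine sum_congr rfl fun j hj => ?_
      rw [show p + 1 + 1 - j = (p + 1 - j) + 1 by have := (mem_Icc.1 hj).2; omega]
      field_simp
      ring
    rw [sum_Icc_succ_top (by omega), h1, eq_sub_of_add_eq ih]
    obtain ⟨r, rfl⟩ : ∃ r, p = r + 1 := ⟨p - 1, by omega⟩
    simp only [Nat.add_sub_cancel, show r + 1 + 1 + 1 - (r + 1 + 1) = 1 by omega]
    field_simp
    ring

/-! ### Harmonic numbers: finite and infinite sums, growth. -/

/-- The `n`-th harmonic number as a real number. -/
noncomputable def harmonicReal (n : ℕ) : ℝ := ∑ i ∈ Finset.range n, 1 / ((i : ℝ) + 1)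

lemma harmonicReal_nonneg (n : ℕ) : 0 ≤ harmonicReal n :=
  Finset.sum_nonneg fun _ _ => by positivity

lemma harmonicReal_succ (n : ℕ) : harmonicReal (n + 1) = harmonicReal n + 1 / ((n : ℝ) + 1) :=
  Finset.sum_range_succ _ _

lemma harmonicReal_mono : Monotone harmonicReal :=
  monotone_nat_of_le_succ fun n => by
    rw [harmonicReal_succ]
    have : 0 ≤ 1 / ((n : ℝ) + 1) := by positivity
    linarith

open Finset in
lemma sum_Ioo_one_div_sub {m k : ℕ} (h : m < k) :
    ∑ l ∈ Ioo m k, 1 / ((k : ℝ) - l) = harmonicReal (k - m - 1) := by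
  obtain ⟨r, rfl⟩ : ∃ r, k = m + 1 + r := ⟨k - m - 1, by omega⟩
  rw [show Ioo m (m + 1 + r) = Ico (m + 1) (m + 1 + r) by ext; simp,
    sum_Ico_eq_sum_range, show m + 1 + r - (m + 1) = r by omega,
    show m + 1 + r - m - 1 = r by omega, harmonicReal, ← sum_range_reflect]
  refine sum_congr rfl fun i hi => ?_
  have : i < r := mem_range.1 hi
  rw [show r - 1 - i = r - (1 + i) by omega]
  push_cast [show 1 + i ≤ r by omega]
  congr 1
  ring

open Finset in
-- Partial fractions: `1 / (l * (l - m)) = (1 / (l - m) - 1 / l) / m`, and both parts sum to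
-- harmonic numbers.
lemma sum_Ioo_one_div_mul_sub {m k : ℕ} (hm : 0 < m) (h : m < k) :
    ∑ l ∈ Ioo m k, 1 / ((l : ℝ) * (l - m)) =
      (harmonicReal (k - m - 1) + harmonicReal m - harmonicReal (k - 1)) / m := by
  obtain ⟨r, rfl⟩ : ∃ r, k = m + 1 + r := ⟨k - m - 1, by omega⟩
  rw [show Ioo m (m + 1 + r) = Ico (m + 1) (m + 1 + r) by ext; simp,
    sum_Ico_eq_sum_range, show m + 1 + r - (m + 1) = r by omega,
    show m + 1 + r - m - 1 = r by omega, show m + 1 + r - 1 = m + r by omega]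
  have hm' : (0 : ℝ) < m := by exact_mod_cast hm
  clear h
  induction r with
  | zero => simp [harmonicReal]
  | succ r ih =>
    rw [sum_range_succ, ih, ← add_assoc m r 1, harmonicReal_succ, harmonicReal_succ]
    have h2 : (m : ℝ) + 1 + r - m = r + 1 := by ring
    push_cast
    rw [h2]
    field_simp
    ring

/-- With `k = m + 1 + r` this is the sum of `1 / (k * (k - m))` over `k > m`. After partial
fractions, raising `m` by one adds a telescoping series with sum `1 / (m + 1)`. -/
lemma hasSum_one_div_mul_add (m : ℕ) (hm : 0 < m) :
    HasSum (fun r : ℕ => 1 / (((m : ℝ) + 1 + r) * (r + 1))) (harmonicReal m / m) := by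
  have key : ∀ m : ℕ, HasSum (fun r : ℕ => 1 / ((r : ℝ) + 1) - 1 / ((m : ℝ) + 1 + r))
      (harmonicReal m) := by
    intro m
    induction m with
    | zero =>
      have : (fun r : ℕ => 1 / ((r : ℝ) + 1) - 1 / (((0 : ℕ) : ℝ) + 1 + r)) = fun _ => 0 := by
        funext r
        rw [sub_eq_zero]
        congr 1
        push_cast
        ring
      rw [this]
      simp [harmonicReal]
    | succ m ih =>
      have step : HasSum (fun r : ℕ => 1 / ((m : ℝ) + 1 + r) - 1 / ((m : ℝ) + 1 + 1 + r))
          (1 / ((m : ℝ) + 1)) := by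
        rw [hasSum_iff_tendsto_nat_of_nonneg]
        · have hs : ∀ N : ℕ, ∑ r ∈ Finset.range N,
              (1 / ((m : ℝ) + 1 + r) - 1 / ((m : ℝ) + 1 + 1 + r)) =
              1 / ((m : ℝ) + 1) - 1 / ((m : ℝ) + 1 + N) := by
            intro N
            induction N with
            | zero => simp
            | succ N ih =>
              rw [Finset.sum_range_succ, ih]
              push_cast
              rw [show (m : ℝ) + 1 + 1 + N = m + 1 + (N + 1) by ring]
              ring
          simp_rw [hs]
          have : Filter.Tendsto (fun N : ℕ => 1 / ((m : ℝ) + 1 + N)) Filter.atTop (nhds 0) := by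
            simp_rw [one_div]
            exact (Filter.tendsto_atTop_add_const_left _ _
              tendsto_natCast_atTop_atTop).inv_tendsto_atTop
          simpa using tendsto_const_nhds.sub this
        · intro r
          rw [sub_nonneg]
          gcongr
          linarith
      rw [harmonicReal_succ]
      convert ih.add step using 2 with r
      push_cast
      ring
  have hm' : (0 : ℝ) < m := by exact_mod_cast hm
  have e : (fun r : ℕ => 1 / (((m : ℝ) + 1 + r) * (r + 1))) =
      fun r : ℕ => (1 / ((r : ℝ) + 1) - 1 / ((m : ℝ) + 1 + r)) / m := by
    funext r
    have h1 : (r : ℝ) + 1 ≠ 0 := by positivity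
    have h2 : (m : ℝ) + 1 + r ≠ 0 := by positivity
    field_simp
    ring
  rw [e]
  exact (key m).div_const _

/-- Any exponent below `1 / 2` would make `H n ^ 2 / n ^ 2` summable; `1 / 4` gives the majorant `25
/ n ^ (3 / 2)`. -/
lemma harmonicReal_le_rpow (n : ℕ) : harmonicReal n ≤ 5 * (n : ℝ) ^ (1 / 4 : ℝ) := by
  rcases Nat.eq_zero_or_pos n with rfl | hn
  · simp [harmonicReal]
  have h1 : harmonicReal n ≤ 1 + Real.log n := by
    refine le_of_eq_of_le ?_ (harmonic_le_one_add_log n)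
    simp [harmonicReal, harmonic]
  have h2 : Real.log n ≤ (n : ℝ) ^ (1 / 4 : ℝ) / (1 / 4) :=
    Real.log_le_rpow_div (by positivity) (by norm_num)
  have h3 : 1 ≤ (n : ℝ) ^ (1 / 4 : ℝ) :=
    Real.one_le_rpow (by exact_mod_cast hn) (by norm_num)
  linarith

lemma summable_harmonicReal_sq_div_sq :
    Summable fun n : ℕ => harmonicReal n ^ 2 / (n : ℝ) ^ 2 := by
  have hs : Summable fun n : ℕ => 25 * (1 / (n : ℝ) ^ (3 / 2 : ℝ)) :=
    (Real.summable_one_div_nat_rpow.2 (by norm_num)).mul_left 25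
  refine hs.of_nonneg_of_le (fun n => by positivity) fun n => ?_
  rcases Nat.eq_zero_or_pos n with rfl | hn
  · simp
  have hn' : (0 : ℝ) < n := by exact_mod_cast hn
  have h1 : harmonicReal n ^ 2 ≤ (5 * (n : ℝ) ^ (1 / 4 : ℝ)) ^ 2 :=
    pow_le_pow_left₀ (harmonicReal_nonneg n) (harmonicReal_le_rpow n) 2
  have h2 : ((n : ℝ) ^ (1 / 4 : ℝ)) ^ 2 * (n : ℝ) ^ (3 / 2 : ℝ) = (n : ℝ) ^ 2 := by
    rw [← Real.rpow_natCast, ← Real.rpow_mul hn'.le, ← Real.rpow_add hn', ← Real.rpow_natCast]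
    norm_num
  have h3 : 0 < (n : ℝ) ^ (3 / 2 : ℝ) := Real.rpow_pos_of_pos hn' _
  rw [mul_one_div, div_le_div_iff₀ (by positivity) h3, ← h2]
  calc _ ≤ (5 * (n : ℝ) ^ (1 / 4 : ℝ)) ^ 2 * (n : ℝ) ^ (3 / 2 : ℝ) := by gcongr
    _ = _ := by ring

/-! ### Double and triple sums in `[0, ∞]`. -/

open scoped ENNReal

/-- `∑_{k > m > 0} G k m` in `[0, ∞]`. -/
noncomputable def pairSum (G : ℕ → ℕ → ℝ) : ℝ≥0∞ :=
  ∑' (k : ℕ) (m : ℕ), if 0 < m ∧ m < k then ENNReal.ofReal (G k m) else 0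

/-- `∑_{k > l > m > 0} F k l m` in `[0, ∞]`. -/
noncomputable def tripleSum (F : ℕ → ℕ → ℕ → ℝ) : ℝ≥0∞ :=
  ∑' (k : ℕ) (l : ℕ) (m : ℕ), if 0 < m ∧ m < l ∧ l < k then ENNReal.ofReal (F k l m) else 0

lemma pairSum_congr {G G' : ℕ → ℕ → ℝ} (h : ∀ k m, 0 < m → m < k → G k m = G' k m) :
    pairSum G = pairSum G' :=
  tsum_congr fun k => tsum_congr fun m => by
    split_ifs with hc
    · rw [h k m hc.1 hc.2]
    · rfl

lemma pairSum_mono {G G' : ℕ → ℕ → ℝ} (h : ∀ k m, 0 < m → m < k → G k m ≤ G' k m) :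
    pairSum G ≤ pairSum G' :=
  ENNReal.tsum_le_tsum fun k => ENNReal.tsum_le_tsum fun m => by
    split_ifs with hc
    · exact ENNReal.ofReal_le_ofReal (h k m hc.1 hc.2)
    · rfl

lemma pairSum_add {G G' : ℕ → ℕ → ℝ} (h : ∀ k m, 0 < m → m < k → 0 ≤ G k m)
    (h' : ∀ k m, 0 < m → m < k → 0 ≤ G' k m) :
    pairSum (fun k m => G k m + G' k m) = pairSum G + pairSum G' := by
  simp only [pairSum, ← ENNReal.tsum_add]
  refine tsum_congr fun k => tsum_congr fun m => ?_
  split_ifs with hc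
  · exact ENNReal.ofReal_add (h k m hc.1 hc.2) (h' k m hc.1 hc.2)
  · simp

lemma tripleSum_congr {F F' : ℕ → ℕ → ℕ → ℝ}
    (h : ∀ k l m, 0 < m → m < l → l < k → F k l m = F' k l m) :
    tripleSum F = tripleSum F' :=
  tsum_congr fun k => tsum_congr fun l => tsum_congr fun m => by
    split_ifs with hc
    · rw [h k l m hc.1 hc.2.1 hc.2.2]
    · rfl

lemma tripleSum_add {F F' : ℕ → ℕ → ℕ → ℝ}
    (h : ∀ k l m, 0 < m → m < l → l < k → 0 ≤ F k l m)
    (h' : ∀ k l m, 0 < m → m < l → l < k → 0 ≤ F' k l m) :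
    tripleSum (fun k l m => F k l m + F' k l m) = tripleSum F + tripleSum F' := by
  simp only [tripleSum, ← ENNReal.tsum_add]
  refine tsum_congr fun k => tsum_congr fun l => tsum_congr fun m => ?_
  split_ifs with hc
  · exact ENNReal.ofReal_add (h k l m hc.1 hc.2.1 hc.2.2) (h' k l m hc.1 hc.2.1 hc.2.2)
  · simp

lemma tripleSum_sum {ι : Type*} (s : Finset ι) {F : ι → ℕ → ℕ → ℕ → ℝ}
    (h : ∀ i k l m, 0 < m → m < l → l < k → 0 ≤ F i k l m) :
    tripleSum (fun k l m => ∑ i ∈ s, F i k l m) = ∑ i ∈ s, tripleSum (F i) := by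
  classical
  induction s using Finset.induction_on with
  | empty => simp [tripleSum]
  | insert i s hi ih =>
    simp only [Finset.sum_insert hi]
    rw [← ih]
    exact tripleSum_add (h i) fun k l m h1 h2 h3 => Finset.sum_nonneg fun j _ => h j k l m h1 h2 h3

lemma ite_ofReal_nonneg_tsum {s : Finset ℕ} {p : ℕ → Prop} [DecidablePred p] {f : ℕ → ℝ}
    (hp : ∀ i, p i ↔ i ∈ s) (hf : ∀ i ∈ s, 0 ≤ f i) :
    (∑' i, if p i then ENNReal.ofReal (f i) else 0) = ENNReal.ofReal (∑ i ∈ s, f i) := by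
  rw [tsum_eq_sum (s := s) fun i hi => if_neg fun h => hi ((hp i).1 h),
    ENNReal.ofReal_sum_of_nonneg hf]
  exact Finset.sum_congr rfl fun i hi => if_pos ((hp i).2 hi)

lemma tripleSum_eq_pairSum_sum_middle {F : ℕ → ℕ → ℕ → ℝ}
    (h : ∀ k l m, 0 < m → m < l → l < k → 0 ≤ F k l m) :
    tripleSum F = pairSum fun k m => ∑ l ∈ Finset.Ioo m k, F k l m := by
  refine tsum_congr fun k => ?_
  rw [ENNReal.tsum_comm]
  refine tsum_congr fun m => ?_
  split_ifs with hc
  · refine ite_ofReal_nonneg_tsum (fun l => ?_) fun l hl => ?_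
    · rw [Finset.mem_Ioo]
      tauto
    · rw [Finset.mem_Ioo] at hl
      exact h k l m hc.1 hl.1 hl.2
  · exact ENNReal.tsum_eq_zero.2 fun l => if_neg fun hl => hc ⟨hl.1, hl.2.1.trans hl.2.2⟩

lemma tripleSum_eq_pairSum_sum_last {F : ℕ → ℕ → ℕ → ℝ}
    (h : ∀ k l m, 0 < m → m < l → l < k → 0 ≤ F k l m) :
    tripleSum F = pairSum fun k l => ∑ m ∈ Finset.Ioo 0 l, F k l m := by
  refine tsum_congr fun k => tsum_congr fun l => ?_
  split_ifs with hc
  · refine ite_ofReal_nonneg_tsum (fun m => ?_) fun m hm => ?_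
    · rw [Finset.mem_Ioo]
      tauto
    · rw [Finset.mem_Ioo] at hm
      exact h k l m hm.1 hm.2 hc.2
  · exact ENNReal.tsum_eq_zero.2 fun m => if_neg fun hm => hc ⟨hm.1.trans hm.2.1, hm.2.2⟩

lemma tripleSum_div_mul_sub_first {g : ℕ → ℕ → ℝ} (hg : ∀ l m, 0 ≤ g l m) :
    tripleSum (fun k l m => g l m * (1 / ((k : ℝ) * (k - l)))) =
      pairSum fun l m => g l m * (harmonicReal l / l) := by
  unfold tripleSum
  rw [ENNReal.tsum_comm]
  refine tsum_congr fun l => ?_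
  rw [ENNReal.tsum_comm]
  refine tsum_congr fun m => ?_
  split_ifs with hc
  · have hl : 0 < l := hc.1.trans hc.2
    have hH := hasSum_one_div_mul_add l hl
    beta_reduce
    rw [← hH.tsum_eq, ← tsum_mul_left, ENNReal.ofReal_tsum_of_nonneg
      (fun r => mul_nonneg (hg l m) (by positivity)) (hH.summable.mul_left _),
      -- The terms with `k ≤ l` vanish; the others are indexed by `k = l + 1 + r`.
      ← Summable.sum_add_tsum_nat_add' (f := fun k : ℕ => if 0 < m ∧ m < l ∧ l < k then
          ENNReal.ofReal (g l m * (1 / ((k : ℝ) * (k - l)))) else 0) (k := l + 1)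
          ENNReal.summable,
      Finset.sum_eq_zero, zero_add]
    · refine tsum_congr fun r => ?_
      rw [if_pos ⟨hc.1, hc.2, by omega⟩]
      push_cast
      congr 4
      · ring
      · ring
    · intro i hi
      rw [Finset.mem_range] at hi
      exact if_neg fun h => by omega
  · exact ENNReal.tsum_eq_zero.2 fun k => if_neg fun hk => hc ⟨hk.1, hk.2.1⟩

/-! ### The depth-two derivation relation. -/

/-- The summand of the double zeta value `ζ(p, q)`. -/
noncomputable def doubleTerm (p q k m : ℕ) : ℝ := 1 / ((k : ℝ) ^ p * (m : ℝ) ^ q)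

lemma doubleTerm_nonneg (p q k m : ℕ) : 0 ≤ doubleTerm p q k m := by
  unfold doubleTerm
  positivity

/-- The summand of the triple zeta value `ζ(p, q, r)`. -/
noncomputable def tripleTerm (p q r k l m : ℕ) : ℝ :=
  1 / ((k : ℝ) ^ p * (l : ℝ) ^ q * (m : ℝ) ^ r)

lemma tripleTerm_nonneg (p q r k l m : ℕ) : 0 ≤ tripleTerm p q r k l m := by
  unfold tripleTerm
  positivity

/-- The worst case is `p = 2`, `q = 1`, where the sum over `m` is at most `H k`, leaving the
convergent series of `H k ^ 2 / k ^ 2`. -/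
lemma pairSum_doubleTerm_mul_harmonicReal_ne_top {p q : ℕ} (hp : 2 ≤ p) (hq : 1 ≤ q) :
    pairSum (fun k m => doubleTerm p q k m * harmonicReal k) ≠ ∞ := by
  have hs := summable_harmonicReal_sq_div_sq
  refine ne_top_of_le_ne_top hs.tsum_ofReal_ne_top (ENNReal.tsum_le_tsum fun k => ?_)
  have key : (∑' m : ℕ, if 0 < m ∧ m < k then
      ENNReal.ofReal (doubleTerm p q k m * harmonicReal k) else 0) =
      ENNReal.ofReal (∑ m ∈ Finset.Ioo 0 k, doubleTerm p q k m * harmonicReal k) :=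
    ite_ofReal_nonneg_tsum (fun m => by simp) fun m _ =>
      mul_nonneg (doubleTerm_nonneg _ _ _ _) (harmonicReal_nonneg _)
  rw [key]
  refine ENNReal.ofReal_le_ofReal ?_
  rcases Nat.eq_zero_or_pos k with rfl | hk
  · simp
  have hk1 : (1 : ℝ) ≤ k := by exact_mod_cast hk
  have h1 : ∀ m ∈ Finset.Ioo 0 k, doubleTerm p q k m * harmonicReal k ≤
      1 / (k : ℝ) ^ 2 * (1 / (m : ℝ)) * harmonicReal k := by
    intro m hm
    have hm1 : (1 : ℝ) ≤ m := by exact_mod_cast (Finset.mem_Ioo.1 hm).1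
    refine mul_le_mul_of_nonneg_right ?_ (harmonicReal_nonneg k)
    rw [doubleTerm, one_div_mul_one_div]
    refine one_div_le_one_div_of_le (by positivity) (mul_le_mul (pow_le_pow_right₀ hk1 hp)
      (le_self_pow₀ hm1 (by omega)) (by positivity) (by positivity))
  have h2 : ∑ m ∈ Finset.Ioo 0 k, 1 / (m : ℝ) ≤ harmonicReal k := by
    rw [show Finset.Ioo 0 k = Finset.Ico 1 k by ext; simp [Nat.succ_le_iff, Nat.pos_iff_ne_zero],
      Finset.sum_Ico_eq_sum_range]
    refine le_trans (le_of_eq ?_) (harmonicReal_mono (Nat.sub_le k 1))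
    refine Finset.sum_congr rfl fun i _ => ?_
    push_cast
    rw [add_comm]
  calc _ ≤ ∑ m ∈ Finset.Ioo 0 k, 1 / (k : ℝ) ^ 2 * (1 / (m : ℝ)) * harmonicReal k :=
        Finset.sum_le_sum h1
    _ = 1 / (k : ℝ) ^ 2 * (∑ m ∈ Finset.Ioo 0 k, 1 / (m : ℝ)) * harmonicReal k := by
        rw [Finset.mul_sum, Finset.sum_mul]
    _ ≤ 1 / (k : ℝ) ^ 2 * harmonicReal k * harmonicReal k := by
        have := harmonicReal_nonneg k
        gcongr
    _ = _ := by ring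

/-- The geometric sum is taken in `k, l` with `m` fixed. Its subtracted term is moved to the left to
avoid subtraction in `[0, ∞]` and is summed over the middle variable; the main term is summed over
the largest. -/
lemma sum_tripleSum_split_first {p q : ℕ} (hp : 2 ≤ p) :
    ∑ j ∈ Finset.Icc 2 p, tripleSum (tripleTerm j (p + 1 - j) q) +
        pairSum (fun k m => doubleTerm p q k m * harmonicReal (k - m - 1)) =
      pairSum fun k m => doubleTerm p q k m * harmonicReal k := by
  have e1 : pairSum (fun k m => doubleTerm p q k m * harmonicReal (k - m - 1)) =
      tripleSum fun k l m => doubleTerm p q k m * (1 / ((k : ℝ) - l)) := by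
    rw [tripleSum_eq_pairSum_sum_middle]
    · refine pairSum_congr fun k m _ hmk => ?_
      rw [← Finset.mul_sum, sum_Ioo_one_div_sub hmk]
    · intro k l m _ _ hlk
      have : (0 : ℝ) < k - l := sub_pos.2 (by exact_mod_cast hlk)
      exact mul_nonneg (doubleTerm_nonneg _ _ _ _) (by positivity)
  have e2 : pairSum (fun k m => doubleTerm p q k m * harmonicReal k) =
      tripleSum fun k l m => doubleTerm (p - 1) q l m * (1 / ((k : ℝ) * (k - l))) := by
    rw [tripleSum_div_mul_sub_first (doubleTerm_nonneg _ _)]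
    refine pairSum_congr fun k m hm hmk => ?_
    obtain ⟨r, rfl⟩ : ∃ r, p = r + 1 := ⟨p - 1, by omega⟩
    have : (k : ℝ) ≠ 0 := by exact_mod_cast (hm.trans hmk).ne'
    have : (m : ℝ) ≠ 0 := by exact_mod_cast hm.ne'
    simp only [doubleTerm, Nat.add_sub_cancel]
    field_simp
    ring
  rw [e1, e2, ← tripleSum_sum _ fun _ _ _ _ _ _ _ => tripleTerm_nonneg _ _ _ _ _ _,
    ← tripleSum_add]
  · refine tripleSum_congr fun k l m hm hml hlk => ?_
    have hl : (0 : ℝ) < l := by exact_mod_cast hm.trans hml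
    have hlk' : (l : ℝ) < k := by exact_mod_cast hlk
    have hm' : (m : ℝ) ≠ 0 := by exact_mod_cast hm.ne'
    have hd : (k : ℝ) - l ≠ 0 := (sub_pos.2 hlk').ne'
    have hk : (k : ℝ) ≠ 0 := (hl.trans hlk').ne'
    have := sum_inv_pow_mul_inv_pow (hl.trans hlk') hl hlk' (p := p) (by omega)
    calc _ = (∑ j ∈ Finset.Icc 2 p, 1 / ((k : ℝ) ^ j * (l : ℝ) ^ (p + 1 - j)) +
          1 / ((k : ℝ) ^ p * (k - l))) * (1 / (m : ℝ) ^ q) := by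
          rw [add_mul, Finset.sum_mul]
          congr 1
          · exact Finset.sum_congr rfl fun j _ => (one_div_mul_one_div _ _).symm
          · rw [doubleTerm]
            field_simp
      _ = _ := by
          rw [this, doubleTerm]
          field_simp
  · exact fun _ _ _ _ _ _ => Finset.sum_nonneg fun _ _ => tripleTerm_nonneg _ _ _ _ _ _
  · intro k l m _ _ hlk
    have : (0 : ℝ) < k - l := sub_pos.2 (by exact_mod_cast hlk)
    exact mul_nonneg (doubleTerm_nonneg _ _ _ _) (by positivity)

/-- Here the geometric sum is taken in `l, m` with `k` fixed. The moved term is summed over the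
smallest variable, the main term over the middle one. -/
lemma sum_tripleSum_split_second {p q : ℕ} (hq : 1 ≤ q) :
    ∑ j ∈ Finset.Icc 2 q, tripleSum (tripleTerm p j (q + 1 - j)) +
        pairSum (fun k m => doubleTerm p q k m * harmonicReal (m - 1)) =
      pairSum fun k m => doubleTerm p q k m *
        (harmonicReal (k - m - 1) + harmonicReal m - harmonicReal (k - 1)) := by
  have e1 : pairSum (fun k m => doubleTerm p q k m * harmonicReal (m - 1)) =
      tripleSum fun k l m => doubleTerm p q k l * (1 / ((l : ℝ) - m)) := by
    rw [tripleSum_eq_pairSum_sum_last]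
    · refine pairSum_congr fun k m hm _ => ?_
      rw [← Finset.mul_sum, sum_Ioo_one_div_sub hm, Nat.sub_zero]
    · intro k l m _ hml _
      have : (0 : ℝ) < l - m := sub_pos.2 (by exact_mod_cast hml)
      exact mul_nonneg (doubleTerm_nonneg _ _ _ _) (by positivity)
  have e2 : pairSum (fun k m => doubleTerm p q k m *
        (harmonicReal (k - m - 1) + harmonicReal m - harmonicReal (k - 1))) =
      tripleSum fun k l m => doubleTerm p (q - 1) k m * (1 / ((l : ℝ) * (l - m))) := by
    rw [tripleSum_eq_pairSum_sum_middle]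
    · refine pairSum_congr fun k m hm hmk => ?_
      rw [← Finset.mul_sum, sum_Ioo_one_div_mul_sub hm hmk]
      obtain ⟨r, rfl⟩ : ∃ r, q = r + 1 := ⟨q - 1, by omega⟩
      have : (k : ℝ) ≠ 0 := by exact_mod_cast (hm.trans hmk).ne'
      have : (m : ℝ) ≠ 0 := by exact_mod_cast hm.ne'
      simp only [doubleTerm, Nat.add_sub_cancel]
      field_simp
      ring
    · intro k l m _ hml _
      have : (0 : ℝ) < l - m := sub_pos.2 (by exact_mod_cast hml)
      exact mul_nonneg (doubleTerm_nonneg _ _ _ _) (by positivity)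
  rw [e1, e2, ← tripleSum_sum _ fun _ _ _ _ _ _ _ => tripleTerm_nonneg _ _ _ _ _ _,
    ← tripleSum_add]
  · refine tripleSum_congr fun k l m hm hml hlk => ?_
    have hm' : (0 : ℝ) < m := by exact_mod_cast hm
    have hml' : (m : ℝ) < l := by exact_mod_cast hml
    have hk : (k : ℝ) ≠ 0 := by exact_mod_cast (hm.trans (hml.trans hlk)).ne'
    have hd : (l : ℝ) - m ≠ 0 := (sub_pos.2 hml').ne'
    have hl : (l : ℝ) ≠ 0 := (hm'.trans hml').ne'
    have := sum_inv_pow_mul_inv_pow (hm'.trans hml') hm' hml' (p := q) hq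
    calc _ = 1 / (k : ℝ) ^ p * (∑ j ∈ Finset.Icc 2 q, 1 / ((l : ℝ) ^ j * (m : ℝ) ^ (q + 1 - j)) +
          1 / ((l : ℝ) ^ q * (l - m))) := by
          rw [mul_add, Finset.mul_sum]
          congr 1
          · refine Finset.sum_congr rfl fun j _ => ?_
            rw [one_div_mul_one_div, ← mul_assoc, tripleTerm]
          · rw [doubleTerm]
            field_simp
      _ = _ := by
          rw [this, doubleTerm]
          field_simp
  · exact fun _ _ _ _ _ _ => Finset.sum_nonneg fun _ _ => tripleTerm_nonneg _ _ _ _ _ _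
  · intro k l m _ hml _
    have : (0 : ℝ) < l - m := sub_pos.2 (by exact_mod_cast hml)
    exact mul_nonneg (doubleTerm_nonneg _ _ _ _) (by positivity)

/-- Hoffman's derivation relation in depth two, in `[0, ∞]`. -/
theorem sum_tripleSum_eq_pairSum {p q : ℕ} (hp : 2 ≤ p) (hq : 1 ≤ q) :
    ∑ j ∈ Finset.Icc 2 p, tripleSum (tripleTerm j (p + 1 - j) q) +
        ∑ j ∈ Finset.Icc 2 q, tripleSum (tripleTerm p j (q + 1 - j)) =
      pairSum (doubleTerm (p + 1) q) + pairSum (doubleTerm p (q + 1)) := by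
  have hfin := pairSum_doubleTerm_mul_harmonicReal_ne_top hp hq
  have h0 : ∀ k m, 0 ≤ doubleTerm p q k m := doubleTerm_nonneg p q
  have hmono : ∀ f : ℕ → ℕ → ℕ, (∀ k m, m < k → f k m ≤ k) →
      pairSum (fun k m => doubleTerm p q k m * harmonicReal (f k m)) ≠ ∞ := fun f hf =>
    ne_top_of_le_ne_top hfin <| pairSum_mono fun k m _ hmk =>
      mul_le_mul_of_nonneg_left (harmonicReal_mono (hf k m hmk)) (h0 k m)
  have hX := hmono (fun k m => k - m - 1) fun k m _ => by omega
  have hY := hmono (fun _ m => m - 1) fun k m _ => by omega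
  have hA := sum_tripleSum_split_first (q := q) hp
  have hB := sum_tripleSum_split_second (p := p) hq
  have hnn : ∀ k m n, 0 ≤ doubleTerm p q k m * harmonicReal n := fun k m n =>
    mul_nonneg (h0 k m) (harmonicReal_nonneg n)
  have hB0 : ∀ k m, 0 < m → m < k → 0 ≤ doubleTerm p q k m *
      (harmonicReal (k - m - 1) + harmonicReal m - harmonicReal (k - 1)) := by
    intro k m hm hmk
    refine mul_nonneg (h0 k m) ?_
    have h1 := sum_Ioo_one_div_mul_sub hm hmk
    have hm' : (0 : ℝ) < m := by exact_mod_cast hm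
    have h2 : 0 ≤ ∑ l ∈ Finset.Ioo m k, 1 / ((l : ℝ) * (l - m)) :=
      Finset.sum_nonneg fun l hl => by
        have : (0 : ℝ) < l - m := sub_pos.2 (by exact_mod_cast (Finset.mem_Ioo.1 hl).1)
        positivity
    rw [h1] at h2
    have := mul_nonneg h2 hm'.le
    rwa [div_mul_cancel₀ _ hm'.ne'] at this
  -- The harmonic weights telescope pointwise to `1 / k + 1 / m`.
  have hC : (pairSum fun k m => doubleTerm p q k m * harmonicReal k) +
      (pairSum fun k m => doubleTerm p q k m *
        (harmonicReal (k - m - 1) + harmonicReal m - harmonicReal (k - 1))) =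
      (pairSum (doubleTerm (p + 1) q) + pairSum (doubleTerm p (q + 1))) +
      ((pairSum fun k m => doubleTerm p q k m * harmonicReal (k - m - 1)) +
        pairSum fun k m => doubleTerm p q k m * harmonicReal (m - 1)) := by
    rw [← pairSum_add (fun k m _ _ => hnn k m k) hB0,
      ← pairSum_add (fun _ _ _ _ => doubleTerm_nonneg _ _ _ _)
        (fun _ _ _ _ => doubleTerm_nonneg _ _ _ _),
      ← pairSum_add (fun k m _ _ => hnn k m _) (fun k m _ _ => hnn k m _),
      ← pairSum_add (fun _ _ _ _ => add_nonneg (doubleTerm_nonneg _ _ _ _)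
        (doubleTerm_nonneg _ _ _ _)) (fun k m _ _ => add_nonneg (hnn k m _) (hnn k m _))]
    refine pairSum_congr fun k m hm hmk => ?_
    obtain ⟨m, rfl⟩ : ∃ m', m = m' + 1 := ⟨m - 1, by omega⟩
    obtain ⟨k, rfl⟩ : ∃ k', k = k' + 1 := ⟨k - 1, by omega⟩
    have h1 : doubleTerm (p + 1) q (k + 1) (m + 1) =
        doubleTerm p q (k + 1) (m + 1) * (1 / ((k : ℝ) + 1)) := by
      simp only [doubleTerm]
      push_cast
      field_simp
      ring
    have h2 : doubleTerm p (q + 1) (k + 1) (m + 1) =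
        doubleTerm p q (k + 1) (m + 1) * (1 / ((m : ℝ) + 1)) := by
      simp only [doubleTerm]
      push_cast
      field_simp
      ring
    simp only [Nat.add_sub_cancel, harmonicReal_succ k, harmonicReal_succ m, h1, h2]
    ring
  rw [← hA, ← hB] at hC
  -- Cancelling the two auxiliary harmonic sums is legitimate because both are finite.
  refine (ENNReal.add_left_inj (ENNReal.add_ne_top.2 ⟨hX, hY⟩)).1 ?_
  rw [← hC]
  ring

/-! ### Transfer to real multiple zeta values. -/

lemma multiZeta_eq_toReal_tsum {d : ℕ} (s : Fin d → ℕ) :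
    multiZeta s = (∑' k : Fin d → ℕ, {k : Fin d → ℕ | StrictAnti k ∧ ∀ i, 0 < k i}.indicator
      (fun k => ENNReal.ofReal (1 / ∏ i, (k i : ℝ) ^ s i)) k).toReal := by
  rw [← tsum_subtype, ENNReal.tsum_toReal_eq fun _ => ENNReal.ofReal_ne_top]
  refine tsum_congr fun k => (ENNReal.toReal_ofReal ?_).symm
  positivity

lemma multiZeta_pair (p q : ℕ) : multiZeta ![p, q] = (pairSum (doubleTerm p q)).toReal := by
  rw [multiZeta_eq_toReal_tsum, ← (finTwoArrowEquiv ℕ).symm.tsum_eq, ENNReal.tsum_prod', pairSum]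
  congr 1
  refine tsum_congr fun k => tsum_congr fun m => ?_
  rw [show (finTwoArrowEquiv ℕ).symm (k, m) = ![k, m] from rfl, Set.indicator_apply]
  refine if_congr ?_ ?_ rfl
  · simp [Fin.strictAnti_iff_succ_lt, Fin.forall_fin_two]
    omega
  · simp [doubleTerm, Fin.prod_univ_two]

/-- Triples as functions on `Fin 3`. -/
def prodEquivFinThree (α : Type*) : α × α × α ≃ (Fin 3 → α) where
  toFun x := ![x.1, x.2.1, x.2.2]
  invFun f := (f 0, f 1, f 2)
  left_inv _ := rfl
  right_inv f := by
    funext i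
    fin_cases i <;> rfl

lemma multiZeta_triple (p q r : ℕ) :
    multiZeta ![p, q, r] = (tripleSum (tripleTerm p q r)).toReal := by
  rw [multiZeta_eq_toReal_tsum, ← (prodEquivFinThree ℕ).tsum_eq, ENNReal.tsum_prod', tripleSum]
  congr 1
  refine tsum_congr fun k => ?_
  rw [ENNReal.tsum_prod']
  refine tsum_congr fun l => tsum_congr fun m => ?_
  rw [show prodEquivFinThree ℕ (k, l, m) = ![k, l, m] from rfl, Set.indicator_apply]
  refine if_congr ?_ ?_ rfl
  · simp [Fin.strictAnti_iff_succ_lt, Fin.forall_fin_succ]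
    omega
  · simp [tripleTerm, Fin.prod_univ_three]

/-- Hoffman's derivation relation in depth two. -/
theorem sum_multiZeta_eq {p q : ℕ} (hp : 2 ≤ p) (hq : 1 ≤ q) :
    ∑ j ∈ Finset.Icc 2 p, multiZeta ![j, p + 1 - j, q] +
        ∑ j ∈ Finset.Icc 2 q, multiZeta ![p, j, q + 1 - j] =
      multiZeta ![p + 1, q] + multiZeta ![p, q + 1] := by
  have hfin : pairSum (doubleTerm (p + 1) q) + pairSum (doubleTerm p (q + 1)) ≠ ⊤ := by
    have h : ∀ p' q', 2 ≤ p' → 1 ≤ q' → pairSum (doubleTerm p' q') ≠ ⊤ := by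
      intro p' q' hp' hq'
      refine ne_top_of_le_ne_top (pairSum_doubleTerm_mul_harmonicReal_ne_top hp' hq')
        (pairSum_mono fun k m hm hmk => le_mul_of_one_le_right (doubleTerm_nonneg _ _ _ _) ?_)
      exact le_trans (by simp [harmonicReal]) (harmonicReal_mono (show 1 ≤ k by omega))
    exact ENNReal.add_ne_top.2 ⟨h _ _ (by omega) hq, h _ _ hp (by omega)⟩
  have key := sum_tripleSum_eq_pairSum hp hq
  have hfin' := hfin
  rw [← key] at hfin'
  obtain ⟨h1, h2⟩ := ENNReal.add_ne_top.1 hfin'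
  obtain ⟨h3, h4⟩ := ENNReal.add_ne_top.1 hfin
  simp only [multiZeta_pair, multiZeta_triple]
  rw [← ENNReal.toReal_add h3 h4, ← key, ENNReal.toReal_add h1 h2,
    ENNReal.toReal_sum (ENNReal.sum_ne_top.1 h1), ENNReal.toReal_sum (ENNReal.sum_ne_top.1 h2)]

/-! ### Reindexing and the weighted sum formula. -/

/-- The outer index is `p = j + k - 1`, so the weight `a ^ (j + k - 1) * b ^ l` is constant on each
inner sum. -/
lemma sum_antidiagonalTuple_three_group_left (n : ℕ) (f : ℕ → ℕ → ℕ → ℝ) :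
    ∑ s ∈ Finset.Nat.antidiagonalTuple 3 n with 2 ≤ s 0 ∧ 1 ≤ s 1 ∧ 1 ≤ s 2,
        f (s 0) (s 1) (s 2) =
      ∑ p ∈ Finset.Icc 2 (n - 2), ∑ j ∈ Finset.Icc 2 p, f j (p + 1 - j) (n - 1 - p) := by
  rw [Finset.sum_sigma']
  refine Finset.sum_bij' (fun s _ => ⟨s 0 + s 1 - 1, s 0⟩)
    (fun x _ => ![x.2, x.1 + 1 - x.2, n - 1 - x.1]) ?_ ?_ ?_ ?_ ?_
  · intro s hs
    simp [Finset.Nat.mem_antidiagonalTuple, Fin.sum_univ_three] at hs ⊢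
    omega
  · rintro ⟨p, j⟩ hs
    simp [Finset.Nat.mem_antidiagonalTuple, Fin.sum_univ_three] at hs ⊢
    omega
  · intro s hs
    simp [Finset.Nat.mem_antidiagonalTuple, Fin.sum_univ_three] at hs
    funext i
    fin_cases i <;> simp <;> omega
  · rintro ⟨p, j⟩ hs
    simp at hs ⊢
    omega
  · intro s hs
    simp [Finset.Nat.mem_antidiagonalTuple, Fin.sum_univ_three] at hs
    dsimp only
    congr 1 <;> omega

lemma sum_antidiagonalTuple_three_group_right (n : ℕ) (f : ℕ → ℕ → ℕ → ℝ) :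
    ∑ s ∈ Finset.Nat.antidiagonalTuple 3 n with 2 ≤ s 0 ∧ 1 ≤ s 1 ∧ 1 ≤ s 2,
        f (s 0) (s 1) (s 2) =
      ∑ p ∈ Finset.Icc 2 (n - 2), ∑ k ∈ Finset.Icc 1 (n - 1 - p), f p k (n - p - k) := by
  rw [Finset.sum_sigma']
  refine Finset.sum_bij' (fun s _ => ⟨s 0, s 1⟩)
    (fun x _ => ![x.1, x.2, n - x.1 - x.2]) ?_ ?_ ?_ ?_ ?_
  · intro s hs
    simp [Finset.Nat.mem_antidiagonalTuple, Fin.sum_univ_three] at hs ⊢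
    omega
  · rintro ⟨p, j⟩ hs
    simp [Finset.Nat.mem_antidiagonalTuple, Fin.sum_univ_three] at hs ⊢
    omega
  · intro s hs
    simp [Finset.Nat.mem_antidiagonalTuple, Fin.sum_univ_three] at hs
    funext i
    fin_cases i <;> simp
    omega
  · rintro ⟨p, j⟩ _
    rfl
  · intro s hs
    simp [Finset.Nat.mem_antidiagonalTuple, Fin.sum_univ_three] at hs
    dsimp only
    congr 1
    omega

lemma sum_antidiagonalTuple_two (n : ℕ) (f : ℕ → ℕ → ℝ) :
    ∑ s ∈ Finset.Nat.antidiagonalTuple 2 n with 2 ≤ s 0 ∧ 1 ≤ s 1, f (s 0) (s 1) =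
      ∑ p ∈ Finset.Icc 2 (n - 1), f p (n - p) := by
  refine Finset.sum_bij' (fun s _ => s 0) (fun p _ => ![p, n - p]) ?_ ?_ ?_ ?_ ?_
  · intro s hs
    simp [Finset.Nat.mem_antidiagonalTuple, Fin.sum_univ_two] at hs ⊢
    omega
  · intro p hs
    simp [Finset.Nat.mem_antidiagonalTuple, Fin.sum_univ_two] at hs ⊢
    omega
  · intro s hs
    simp [Finset.Nat.mem_antidiagonalTuple, Fin.sum_univ_two] at hs
    funext i
    fin_cases i
    · simp
    · simp
      omega
  · intro p _
    rfl
  · intro s hs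
    simp [Finset.Nat.mem_antidiagonalTuple, Fin.sum_univ_two] at hs
    congr 1
    omega

theorem mainTheorem11 (a b : ℝ) (n : ℕ) (hn : 3 ≤ n) :
    (∑ s ∈ Finset.Nat.antidiagonalTuple 3 n with 2 ≤ s 0 ∧ 1 ≤ s 1 ∧ 1 ≤ s 2,
        (a ^ (s 0 + s 1 - 1) * b ^ s 2 + a ^ s 0 * b ^ (s 1 + s 2 - 1)) *
          multiZeta ![s 0, s 1, s 2]) -
      (∑ s ∈ Finset.Nat.antidiagonalTuple 2 n with 2 ≤ s 0 ∧ 1 ≤ s 1,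
        (a ^ (s 0 - 1) * b ^ s 1 + a ^ s 0 * b ^ (s 1 - 1)) *
          multiZeta ![s 0, s 1]) =
    (∑ k ∈ Finset.Icc 2 (n - 2),
        a ^ k * b ^ (n - 1 - k) * multiZeta ![k, 1, n - 1 - k]) -
      a * b ^ (n - 2) * multiZeta ![2, n - 2] -
      a ^ (n - 1) * multiZeta ![n - 1, 1] := by
  simp only [add_mul, Finset.sum_add_distrib]
  rw [sum_antidiagonalTuple_three_group_left n
      fun j k l => a ^ (j + k - 1) * b ^ l * multiZeta ![j, k, l],
    sum_antidiagonalTuple_three_group_right n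
      fun j k l => a ^ j * b ^ (k + l - 1) * multiZeta ![j, k, l],
    sum_antidiagonalTuple_two n fun j k => a ^ (j - 1) * b ^ k * multiZeta ![j, k],
    sum_antidiagonalTuple_two n fun j k => a ^ j * b ^ (k - 1) * multiZeta ![j, k]]
  -- The relation yields `ζ(p + 1, q)` only for `p ≥ 2`, so `ζ(2, n - 2)` is left over; in `hlast`,
  -- `q ≥ 1` likewise leaves `ζ(n - 1, 1)`.
  have hfirst : ∑ p ∈ Finset.Icc 2 (n - 1), a ^ (p - 1) * b ^ (n - p) * multiZeta ![p, n - p] =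
      a * b ^ (n - 2) * multiZeta ![2, n - 2] + ∑ p ∈ Finset.Icc 2 (n - 2),
        a ^ p * b ^ (n - 1 - p) * multiZeta ![p + 1, n - 1 - p] := by
    rw [← Finset.add_sum_Ioc_eq_sum_Icc (by omega : 2 ≤ n - 1)]
    congr 1
    · simp
    · refine (Finset.sum_bij' (fun p _ => p + 1) (fun p _ => p - 1) ?_ ?_ ?_ ?_ ?_).symm
      · intro p hp
        simp at hp ⊢
        omega
      · intro p hp
        simp at hp ⊢
        omega
      · intro p hp
        simp
      · intro p hp
        simp at hp
        omega
      · intro p hp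
        rw [Nat.add_sub_cancel, show n - (p + 1) = n - 1 - p by omega]
  have hlast : ∑ p ∈ Finset.Icc 2 (n - 1), a ^ p * b ^ (n - p - 1) * multiZeta ![p, n - p] =
      (∑ p ∈ Finset.Icc 2 (n - 2), a ^ p * b ^ (n - 1 - p) * multiZeta ![p, n - 1 - p + 1]) +
        a ^ (n - 1) * multiZeta ![n - 1, 1] := by
    obtain ⟨r, rfl⟩ : ∃ r, n = r + 2 := ⟨n - 2, by omega⟩
    rw [show r + 2 - 1 = r + 1 by omega, show r + 2 - 2 = r by omega,
      Finset.sum_Icc_succ_top (by omega)]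
    congr 1
    · refine Finset.sum_congr rfl fun p hp => ?_
      have := (Finset.mem_Icc.1 hp).2
      rw [show r + 2 - p - 1 = r + 1 - p by omega, show r + 1 - p + 1 = r + 2 - p by omega]
    · rw [show r + 2 - (r + 1) = 1 by omega]
      simp
  have hmain : (∑ p ∈ Finset.Icc 2 (n - 2), ∑ j ∈ Finset.Icc 2 p,
        a ^ (j + (p + 1 - j) - 1) * b ^ (n - 1 - p) * multiZeta ![j, p + 1 - j, n - 1 - p]) +
      (∑ p ∈ Finset.Icc 2 (n - 2), ∑ k ∈ Finset.Icc 1 (n - 1 - p),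
        a ^ p * b ^ (k + (n - p - k) - 1) * multiZeta ![p, k, n - p - k]) =
      (∑ p ∈ Finset.Icc 2 (n - 2), a ^ p * b ^ (n - 1 - p) * multiZeta ![p + 1, n - 1 - p]) +
      (∑ p ∈ Finset.Icc 2 (n - 2), a ^ p * b ^ (n - 1 - p) * multiZeta ![p, n - 1 - p + 1]) +
      ∑ p ∈ Finset.Icc 2 (n - 2), a ^ p * b ^ (n - 1 - p) * multiZeta ![p, 1, n - 1 - p] := by
    simp only [← Finset.sum_add_distrib]
    refine Finset.sum_congr rfl fun p hp => ?_
    obtain ⟨hp2, hpn⟩ := Finset.mem_Icc.1 hp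
    have hq : 1 ≤ n - 1 - p := by omega
    have e1 : ∑ j ∈ Finset.Icc 2 p, a ^ (j + (p + 1 - j) - 1) * b ^ (n - 1 - p) *
        multiZeta ![j, p + 1 - j, n - 1 - p] =
        a ^ p * b ^ (n - 1 - p) * ∑ j ∈ Finset.Icc 2 p, multiZeta ![j, p + 1 - j, n - 1 - p] := by
      rw [Finset.mul_sum]
      refine Finset.sum_congr rfl fun j hj => ?_
      have := (Finset.mem_Icc.1 hj).2
      rw [show j + (p + 1 - j) - 1 = p by omega]
    have e2 : ∑ k ∈ Finset.Icc 1 (n - 1 - p), a ^ p * b ^ (k + (n - p - k) - 1) *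
        multiZeta ![p, k, n - p - k] =
        a ^ p * b ^ (n - 1 - p) * (multiZeta ![p, 1, n - 1 - p] +
          ∑ k ∈ Finset.Icc 2 (n - 1 - p), multiZeta ![p, k, n - 1 - p + 1 - k]) := by
      -- The relation starts at middle exponent 2; the surplus term with middle exponent 1 produces
      -- the triple zeta values on the right-hand side.
      have e3 : multiZeta ![p, 1, n - 1 - p] +
          ∑ k ∈ Finset.Icc 2 (n - 1 - p), multiZeta ![p, k, n - 1 - p + 1 - k] =
          ∑ k ∈ Finset.Icc 1 (n - 1 - p), multiZeta ![p, k, n - 1 - p + 1 - k] := by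
        rw [← Finset.add_sum_Ioc_eq_sum_Icc hq, Nat.add_sub_cancel]
        rfl
      rw [e3, Finset.mul_sum]
      refine Finset.sum_congr rfl fun k hk => ?_
      have := (Finset.mem_Icc.1 hk).2
      rw [show k + (n - p - k) - 1 = n - 1 - p by omega,
        show n - 1 - p + 1 - k = n - p - k by omega]
    rw [e1, e2]
    linear_combination a ^ p * b ^ (n - 1 - p) * sum_multiZeta_eq hp2 hq
  rw [hmain, hfirst, hlast]
  ring
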